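/- Write $[\ell]=\{1,\dots,\ell\}$ for each integer $\ell\ge 1$. A \emph{minion} $\mathscr{M}$ consists of non-empty sets $\mathscr{M}^{(\ell)}$ for all integers $\ell\geq 1$, with maps $(\cdot)_{/\pi}:\mathscr{M}^{(\ell)}\to\mathscr{M}^{(\ell')}$ for all $\pi:[\ell]\to[\ell']$, such that $M_{/\mathrm{id}}=M$ and $(M_{/\pi})_{/\tilde\pi}=M_{/\tilde\pi\circ\pi}$. A \emph{minion homomorphism} $\mathscr{M}\to\mathscr{N}$ is a family of maps $\xi^{(\ell)}:\mathscr{M}^{(\ell)}\to\mathscr{N}^{(\ell)}$, $\ell\ge 1$, such that $\xi^{(\ell')}(M_{/\pi})=\xi^{(\ell)}(M)_{/\pi}$ for all $M\in\mathscr{M}^{(\ell)}$ and $\pi:[\ell]\to[\ell']$. Let $\mathbb{H}\neq\{0\}$ be a finite-dimensional real or complex Hilbert space. The \emph{quantum minion} $\mathscr{Q}_{\mathbb{H}}$ is the minion for which $\mathscr{Q}_{\mathbb{H}}^{(\ell)}$ is the set of all tuples $(q_1,\dots,q_\ell)$ of pairwise orthogonal linear subspaces of $\mathbb{H}$ whose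 sum is $\mathbb{H}$ (zero subspaces being allowed), and the $i$-th entry of $q_{/\pi}$ is the sum of linear subspaces $\sum_{j\in\pi^{-1}(i)}q_j$ (an empty sum being $\{0\}$). The \emph{dictator minion} (or projection minion) $\mathscr{D}$ is the minion for which $\mathscr{D}^{(\ell)}$ is the set of the $\ell$ standard unit vectors of $\mathbb{R}^\ell$, and the $i$-th entry of $v_{/\pi}$ is $\sum_{j\in\pi^{-1}(i)}v_j$. \textbf{Theorem.} There exists a minion homomorphism $\mathscr{Q}_{\mathbb{H}}\to\mathscr{D}$ if and only if $\dim(\mathbb{H})\leq 2$. -/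

import Mathlib

/-- A (abstract) minion: a non-empty set of `ℓ`-ary elements for each positive integer `ℓ`,
with minor operations along all maps `π : [ℓ] → [ℓ']`, compatible with identities and
composition. -/
structure Minion where
  /-- the set of elements of arity `ℓ` -/
  obj : ℕ+ → Type*
  nonempty : ∀ ℓ, Nonempty (obj ℓ)
  /-- the minor operation along `π`, usually written `M ↦ M_{/π}` -/
  minor : ∀ {ℓ ℓ' : ℕ+}, (Fin ℓ → Fin ℓ') → obj ℓ → obj ℓ'
  minor_id : ∀ {ℓ : ℕ+} (M : obj ℓ), minor id M = M
  minor_minor : ∀ {ℓ ℓ' ℓ'' : ℕ+} (π : Fin ℓ → Fin ℓ') (τ : Fin ℓ' → Fin ℓ'') (M : obj ℓ),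
    minor τ (minor π M) = minor (τ ∘ π) M

/-- A minion homomorphism: a map that preserves arities and minors. -/
structure MinionHom (M : Minion) (N : Minion) where
  toFun : ∀ ℓ : ℕ+, M.obj ℓ → N.obj ℓ
  map_minor : ∀ {ℓ ℓ' : ℕ+} (π : Fin ℓ → Fin ℓ') (m : M.obj ℓ),
    toFun ℓ' (M.minor π m) = N.minor π (toFun ℓ m)

/-- The minor of a column vector `v` over an abelian monoid: the `i`-th entry of `v_{/π}` is the
sum of the entries of `v` with index in `π⁻¹(i)`. -/
def vecMinor {A : Type*} [AddCommMonoid A] {m n : ℕ} (π : Fin m → Fin n) (v : Fin m → A) :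
    Fin n → A :=
  fun i => ∑ j with π j = i, v j

theorem vecMinor_id {A : Type*} [AddCommMonoid A] {m : ℕ} (v : Fin m → A) :
    vecMinor id v = v := by
  funext i
  simp [vecMinor, Finset.sum_filter]

theorem vecMinor_vecMinor {A : Type*} [AddCommMonoid A] {m n k : ℕ} (π : Fin m → Fin n)
    (τ : Fin n → Fin k) (v : Fin m → A) :
    vecMinor τ (vecMinor π v) = vecMinor (τ ∘ π) v := by
  funext i
  simp only [vecMinor, Finset.sum_filter, Function.comp_apply]
  calc _ = ∑ a, ∑ j, if τ a = i then (if π j = a then v j else 0) else 0 := by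
        refine Finset.sum_congr rfl fun a _ => ?_
        split_ifs <;> simp
    _ = ∑ j, ∑ a, if τ a = i then (if π j = a then v j else 0) else 0 := Finset.sum_comm
    _ = _ := by
        refine Finset.sum_congr rfl fun j _ => ?_
        rw [Finset.sum_eq_single (π j)]
        · simp
        · intro b _ hb
          simp [Ne.symm hb]
        · simp

/-- The linear minion over an abelian monoid `A` whose `ℓ`-ary elements are the column vectors in
`P ℓ`. -/
def vecMinion {A : Type*} [AddCommMonoid A] (P : ∀ ℓ : ℕ+, Set (Fin ℓ → A))
    (hne : ∀ ℓ, (P ℓ).Nonempty)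
    (hP : ∀ (ℓ ℓ' : ℕ+) (π : Fin ℓ → Fin ℓ') (v : Fin ℓ → A), v ∈ P ℓ → vecMinor π v ∈ P ℓ') :
    Minion where
  obj ℓ := P ℓ
  nonempty ℓ := (hne ℓ).to_subtype
  minor {ℓ ℓ'} π v := ⟨vecMinor π v.1, hP ℓ ℓ' π v.1 v.2⟩
  minor_id v := Subtype.ext (vecMinor_id v.1)
  minor_minor π τ v := Subtype.ext (vecMinor_vecMinor π τ v.1)

/-- The standard unit vectors of length `ℓ`. -/
def dictatorSet (ℓ : ℕ+) : Set (Fin ℓ → ℝ) :=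
  {v | ∃ i : Fin ℓ, v = Pi.single i 1}

theorem dictatorSet_nonempty (ℓ : ℕ+) : (dictatorSet ℓ).Nonempty :=
  ⟨_, ⟨0, ℓ.pos⟩, rfl⟩

theorem vecMinor_single {m n : ℕ} (π : Fin m → Fin n) (i : Fin m) :
    vecMinor π (Pi.single i (1 : ℝ)) = Pi.single (π i) 1 := by
  funext k
  simp [vecMinor, Pi.single_apply, eq_comm]

theorem dictatorSet_minor (ℓ ℓ' : ℕ+) (π : Fin ℓ → Fin ℓ') (v : Fin ℓ → ℝ)
    (hv : v ∈ dictatorSet ℓ) : vecMinor π v ∈ dictatorSet ℓ' := by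
  obtain ⟨i, rfl⟩ := hv
  exact ⟨π i, vecMinor_single π i⟩

/-- The dictator (projection) minion: the linear minion over `(ℝ, +)` consisting of all standard
unit vectors. -/
def dictatorMinion : Minion :=
  vecMinion dictatorSet dictatorSet_nonempty dictatorSet_minor

section Quantum

variable (𝕜 : Type*) (H : Type*) [RCLike 𝕜] [NormedAddCommGroup H] [InnerProductSpace 𝕜 H]

/-- Tuples of mutually orthogonal subspaces of `H` whose sum is `H`. The sum of subspaces is the
addition of Mathlib's additive monoid structure on `Submodule 𝕜 H`, with zero `⊥`. -/
def quantumSet (ℓ : ℕ+) : Set (Fin ℓ → Submodule 𝕜 H) :=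
  {q | (∀ i j, i ≠ j → q i ⟂ q j) ∧ ∑ i, q i = ⊤}

theorem quantumSet_nonempty (ℓ : ℕ+) : (quantumSet 𝕜 H ℓ).Nonempty := by
  refine ⟨Pi.single ⟨0, ℓ.pos⟩ ⊤, fun i j hij => ?_, by simp⟩
  by_cases hi : i = ⟨0, ℓ.pos⟩
  · have hj : j ≠ ⟨0, ℓ.pos⟩ := fun h => hij (hi.trans h.symm)
    rw [Pi.single_eq_of_ne hj]
    exact Submodule.isOrtho_bot_right
  · rw [Pi.single_eq_of_ne hi]
    exact Submodule.isOrtho_bot_left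

variable {𝕜 H} in
theorem Submodule.isOrtho_finset_sum_left {ι : Type*} (s : Finset ι) (U : ι → Submodule 𝕜 H)
    (V : Submodule 𝕜 H) (h : ∀ i ∈ s, U i ⟂ V) : (∑ i ∈ s, U i) ⟂ V :=
  Finset.sum_induction U (fun W => W ⟂ V)
    (fun _ _ ha hb => Submodule.isOrtho_sup_left.2 ⟨ha, hb⟩) Submodule.isOrtho_bot_left h

theorem quantumSet_minor (ℓ ℓ' : ℕ+) (π : Fin ℓ → Fin ℓ') (q : Fin ℓ → Submodule 𝕜 H)
    (hq : q ∈ quantumSet 𝕜 H ℓ) : vecMinor π q ∈ quantumSet 𝕜 H ℓ' := by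
  refine ⟨fun i j hij => ?_, ?_⟩
  · refine Submodule.isOrtho_finset_sum_left _ _ _ fun a ha => ?_
    refine Submodule.IsOrtho.symm ?_
    refine Submodule.isOrtho_finset_sum_left _ _ _ fun b hb => ?_
    simp only [Finset.mem_filter, Finset.mem_univ, true_and] at ha hb
    refine hq.1 b a fun h => hij ?_
    rw [← ha, ← hb, h]
  · rw [← hq.2]
    exact Finset.sum_fiberwise Finset.univ π q

/-- The quantum minion of `H`: the linear minion, over the additive monoid of linear subspaces of
`H`, of all tuples of mutually orthogonal subspaces with sum `H`. -/
def quantumMinion : Minion :=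
  vecMinion (quantumSet 𝕜 H) (quantumSet_nonempty 𝕜 H) (quantumSet_minor 𝕜 H)

end Quantum

/-! A homomorphism to `dictatorMinion` selects one member of each orthogonal decomposition. Merging
all members but W gives the pair W, Wᗮ, so whether W is selected depends on W alone. Hence
homomorphisms exist exactly when two-valued measures do (`MinionHom.exists_isOrthogonalValuation`,
`IsOrthogonalValuation.nonempty_minionHom`). In dimension at most 2 the only constraints relate W to
Wᗮ, and arbitrary choices satisfy them. In dimension at least 3, some line of an orthonormal basis
is distinguished; with two further basis vectors it spans a 3-space whose integer rays give the
Kochen–Specker contradiction (`kochen_specker_int`). -/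

section OrthogonalValuation

variable {𝕜 H : Type*} [RCLike 𝕜] [NormedAddCommGroup H] [InnerProductSpace 𝕜 H]

/-- A two-valued measure on the subspaces of `H`: every finite orthogonal decomposition of `H` has
exactly one distinguished member. -/
def IsOrthogonalValuation (f : Submodule 𝕜 H → Prop) : Prop :=
  ∀ (n : ℕ) (q : Fin n → Submodule 𝕜 H), (∀ i j, i ≠ j → q i ⟂ q j) → ∑ i, q i = ⊤ → ∃! i, f (q i)

theorem Submodule.IsOrtho.eq_orthogonal_of_sup_eq_top {U V : Submodule 𝕜 H} (h : U ⟂ V)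
    (hs : U ⊔ V = ⊤) : V = Uᗮ := by
  refine le_antisymm h.symm.le fun x hx => ?_
  obtain ⟨u, hu, v, hv, rfl⟩ := Submodule.mem_sup.1 (hs ▸ Submodule.mem_top : x ∈ U ⊔ V)
  have hu' : u ∈ Uᗮ := by simpa using sub_mem hx (h.symm.le hv)
  have : u = 0 := by
    have := (Submodule.mem_orthogonal U u).1 hu' u hu
    simpa using this
  simpa [this] using hv

/-! ### From homomorphisms to valuations -/

theorem dictator_eq_single {ℓ : ℕ+} (v : dictatorMinion.obj ℓ) :
    ∃ i : Fin ℓ, v = ⟨Pi.single i 1, i, rfl⟩ := by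
  obtain ⟨v, i, rfl⟩ := v
  exact ⟨i, rfl⟩

theorem dictator_minor_single {ℓ ℓ' : ℕ+} (π : Fin ℓ → Fin ℓ') (i : Fin ℓ) :
    dictatorMinion.minor π (⟨Pi.single i 1, i, rfl⟩ : dictatorSet ℓ) =
      (⟨Pi.single (π i) 1, π i, rfl⟩ : dictatorSet ℓ') :=
  Subtype.ext (vecMinor_single π i)

theorem dictator_single_inj {ℓ : ℕ+} {i j : Fin ℓ}
    (h : (⟨Pi.single i 1, i, rfl⟩ : dictatorSet ℓ) = ⟨Pi.single j 1, j, rfl⟩) : i = j := by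
  have h' := congrFun (congrArg Subtype.val h) i
  by_contra hij
  simp [hij] at h'

/-- A minion homomorphism to the dictator minion picks one member of every orthogonal decomposition,
compatibly with minors. -/
theorem MinionHom.exists_selector [Nontrivial H]
    (ξ : MinionHom (quantumMinion 𝕜 H) dictatorMinion) :
    ∃ R : ∀ n : ℕ, (Fin n → Submodule 𝕜 H) → Fin n → Prop,
      (∀ n (q : Fin n → Submodule 𝕜 H), (∀ i j, i ≠ j → q i ⟂ q j) → ∑ i, q i = ⊤ →
        ∃! i, R n q i) ∧
      ∀ m n (π : Fin m → Fin n) (q : Fin m → Submodule 𝕜 H) (i : Fin m), R m q i →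
        R n (vecMinor π q) (π i) := by
  refine ⟨fun n q i => ∃ (hn : 0 < n) (h : q ∈ quantumSet 𝕜 H ⟨n, hn⟩),
    ξ.toFun ⟨n, hn⟩ (⟨q, h⟩ : quantumSet 𝕜 H ⟨n, hn⟩) =
      (⟨Pi.single i 1, i, rfl⟩ : dictatorSet ⟨n, hn⟩), fun n q hq hs => ?_, ?_⟩
  · have hn : 0 < n := by
      rcases Nat.eq_zero_or_pos n with rfl | h
      · exact absurd hs bot_ne_top
      · exact h
    obtain ⟨i, hi⟩ := dictator_eq_single
      (ξ.toFun ⟨n, hn⟩ (⟨q, hq, hs⟩ : quantumSet 𝕜 H ⟨n, hn⟩))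
    refine ⟨i, ⟨hn, ⟨hq, hs⟩, hi⟩, ?_⟩
    rintro j ⟨_, _, hj⟩
    exact dictator_single_inj (hj.symm.trans hi)
  · rintro m n π q i ⟨hm, hq, hi⟩
    have hn : 0 < n := (π i).pos
    refine ⟨hn, quantumSet_minor 𝕜 H ⟨m, hm⟩ ⟨n, hn⟩ π q hq, ?_⟩
    have h := ξ.map_minor (ℓ := ⟨m, hm⟩) (ℓ' := ⟨n, hn⟩) π
      (⟨q, hq⟩ : quantumSet 𝕜 H ⟨m, hm⟩)
    rw [hi] at h
    exact h.trans (dictator_minor_single (ℓ := ⟨m, hm⟩) (ℓ' := ⟨n, hn⟩) π i)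

theorem orthogonal_pair [FiniteDimensional 𝕜 H] (W : Submodule 𝕜 H) :
    (∀ i j, i ≠ j → ![W, Wᗮ] i ⟂ ![W, Wᗮ] j) ∧ ∑ i, ![W, Wᗮ] i = ⊤ := by
  constructor
  · intro i j hij
    fin_cases i <;> fin_cases j <;>
      first
      | exact absurd rfl hij
      | exact Submodule.isOrtho_orthogonal_right _
      | exact Submodule.isOrtho_orthogonal_left _
  · simp [Submodule.add_eq_sup, Submodule.sup_orthogonal_of_hasOrthogonalProjection]

/-- The remaining members merge into a subspace orthogonal to `q j` that completes it to H. This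
makes the selection at `q j` independent of the decomposition. -/
theorem vecMinor_eq_pair {n : ℕ} {q : Fin n → Submodule 𝕜 H} (hq : ∀ i j, i ≠ j → q i ⟂ q j)
    (hs : ∑ i, q i = ⊤) (j : Fin n) :
    vecMinor (fun k => if k = j then (0 : Fin 2) else 1) q = ![q j, (q j)ᗮ] := by
  have h0 : vecMinor (fun k => if k = j then (0 : Fin 2) else 1) q 0 = q j := by
    simp [vecMinor, Finset.filter_eq']
  have h1 : vecMinor (fun k => if k = j then (0 : Fin 2) else 1) q 1 = (q j)ᗮ := by
    rw [← h0]
    let π : Fin n → Fin 2 := fun k => if k = j then 0 else 1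
    obtain ⟨ho, hm⟩ := quantumSet_minor 𝕜 H ⟨n, j.pos⟩ 2 π q ⟨hq, hs⟩
    have h01 : vecMinor π q 0 ⟂ vecMinor π q 1 := ho _ _ (Fin.zero_ne_one (n := 0))
    exact h01.eq_orthogonal_of_sup_eq_top ((Fin.sum_univ_two _).symm.trans hm)
  funext k
  fin_cases k
  exacts [h0, h1]

theorem MinionHom.exists_isOrthogonalValuation [FiniteDimensional 𝕜 H] [Nontrivial H]
    (ξ : MinionHom (quantumMinion 𝕜 H) dictatorMinion) :
    ∃ f : Submodule 𝕜 H → Prop, IsOrthogonalValuation f := by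
  obtain ⟨R, hR, hminor⟩ := ξ.exists_selector
  refine ⟨fun W => R 2 ![W, Wᗮ] 0, fun n q hq hs => ?_⟩
  obtain ⟨i, hi, -⟩ := hR n q hq hs
  have key : ∀ j, R 2 ![q j, (q j)ᗮ] (if i = j then 0 else 1) := fun j => by
    rw [← vecMinor_eq_pair hq hs j]
    exact hminor _ _ (fun k => if k = j then (0 : Fin 2) else 1) q i hi
  refine ⟨i, by simpa using key i, fun j hj => ?_⟩
  by_contra hij
  have h := (hR 2 _ (orthogonal_pair (q j)).1 (orthogonal_pair (q j)).2).unique hj (key j)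
  simp [Ne.symm hij] at h

/-! ### From valuations to homomorphisms -/

namespace IsOrthogonalValuation

variable {f : Submodule 𝕜 H → Prop}

theorem not_and_of_isOrtho [FiniteDimensional 𝕜 H] (hf : IsOrthogonalValuation f)
    {U V : Submodule 𝕜 H} (h : U ⟂ V) : ¬ (f U ∧ f V) := by
  rintro ⟨hU, hV⟩
  have hU' : U ⟂ (U ⊔ V)ᗮ := (Submodule.isOrtho_orthogonal_right _).mono_left le_sup_left
  have hV' : V ⟂ (U ⊔ V)ᗮ := (Submodule.isOrtho_orthogonal_right _).mono_left le_sup_right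
  have := (hf 3 ![U, V, (U ⊔ V)ᗮ] (by
    intro i j hij
    fin_cases i <;> fin_cases j <;> first | exact absurd rfl hij | skip
    exacts [h, hU', h.symm, hV', hU'.symm, hV'.symm]) (by
    simp [Fin.sum_univ_three, Submodule.add_eq_sup,
      Submodule.sup_orthogonal_of_hasOrthogonalProjection])).unique
    (y₁ := 0) (y₂ := 1) hU hV
  exact absurd this (by decide)

/-- Otherwise Wᗮ is distinguished, yet orthogonal to U. -/
theorem mono [FiniteDimensional 𝕜 H] (hf : IsOrthogonalValuation f)
    {U W : Submodule 𝕜 H} (h : U ≤ W) (hU : f U) : f W := by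
  obtain ⟨i, hi, -⟩ := hf 2 ![W, Wᗮ] (orthogonal_pair W).1 (orthogonal_pair W).2
  fin_cases i
  · exact hi
  · exact absurd ⟨hU, hi⟩
      (hf.not_and_of_isOrtho ((Submodule.isOrtho_orthogonal_right W).mono_left h))

/-- The distinguished member of `q` lies below the entry of the minor that absorbs it, which is then
distinguished by `mono`; uniqueness gives compatibility. -/
theorem nonempty_minionHom [FiniteDimensional 𝕜 H] (hf : IsOrthogonalValuation f) :
    Nonempty (MinionHom (quantumMinion 𝕜 H) dictatorMinion) := by
  have hex : ∀ (ℓ : ℕ+) (q : quantumSet 𝕜 H ℓ), ∃! i, f (q.1 i) :=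
    fun ℓ q => hf ℓ q.1 q.2.1 q.2.2
  choose c hc hu using hex
  refine ⟨⟨fun ℓ q => (⟨Pi.single (c ℓ q) 1, c ℓ q, rfl⟩ : dictatorSet ℓ), fun {ℓ ℓ'} π q => ?_⟩⟩
  have : π (c ℓ q) = c ℓ' ((quantumMinion 𝕜 H).minor π q) := by
    refine hu _ ((quantumMinion 𝕜 H).minor π q) _ (hf.mono ?_ (hc ℓ q))
    change _ ≤ ∑ j with π j = π (c ℓ q), q.1 j
    exact Finset.single_le_sum (f := q.1) (fun _ _ => bot_le) (by simp)
  rw [dictator_minor_single, this]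

end IsOrthogonalValuation

/-- In dimension at most two, choosing one member of each pair `{W, Wᗮ}` gives a valuation. -/
theorem exists_isOrthogonalValuation_of_finrank_le_two [FiniteDimensional 𝕜 H] [Nontrivial H]
    (h2 : Module.finrank 𝕜 H ≤ 2) : ∃ f : Submodule 𝕜 H → Prop, IsOrthogonalValuation f := by
  -- The well-order only breaks the tie between W and Wᗮ.
  let r : Submodule 𝕜 H → Submodule 𝕜 H → Prop := WellOrderingRel
  let f : Submodule 𝕜 H → Prop := fun W => W = ⊤ ∨ (W ≠ ⊥ ∧ r W Wᗮ)
  have hbot : ¬ f ⊥ := by simp [f, bot_ne_top]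
  have htop : f ⊤ := Or.inl rfl
  have hne : ∀ W : Submodule 𝕜 H, W ≠ Wᗮ := by
    intro W hW
    have h := Submodule.inf_orthogonal_eq_bot W
    rw [← hW, inf_idem] at h
    rw [h, Submodule.bot_orthogonal_eq_top] at hW
    exact bot_ne_top hW
  -- The dimension bound enters here: two nonzero orthogonal subspaces already fill H.
  have hcompl : ∀ {U V : Submodule 𝕜 H}, U ⟂ V → U ≠ ⊥ → V ≠ ⊥ → V = Uᗮ := by
    intro U V h hU hV
    refine h.eq_orthogonal_of_sup_eq_top (Submodule.eq_top_of_finrank_eq ?_)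
    have h1 := Submodule.finrank_sup_add_finrank_inf_eq U V
    rw [h.disjoint.eq_bot, finrank_bot] at h1
    have h3 := Submodule.finrank_le (U ⊔ V)
    have h4 := Submodule.one_le_finrank_iff.2 hU
    have h5 := Submodule.one_le_finrank_iff.2 hV
    omega
  have hnot : ∀ {U V : Submodule 𝕜 H}, U ⟂ V → f U → ¬ f V := by
    intro U V h hfU hfV
    have hU : U ≠ ⊥ := fun h => hbot (h ▸ hfU)
    have hV : V ≠ ⊥ := fun h => hbot (h ▸ hfV)
    obtain rfl := hcompl h hU hV
    rcases hfU with rfl | ⟨-, hU'⟩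
    · exact hV (by simp)
    rcases hfV with h' | ⟨-, hV'⟩
    · exact hU (by simpa using h')
    rw [Submodule.orthogonal_orthogonal] at hV'
    exact asymm_of r hU' hV'
  have hor : ∀ {U V : Submodule 𝕜 H}, U ⟂ V → f (U ⊔ V) → f U ∨ f V := by
    intro U V h hUV
    by_cases hU : U = ⊥
    · subst hU
      exact Or.inr (by simpa using hUV)
    by_cases hV : V = ⊥
    · subst hV
      exact Or.inl (by simpa using hUV)
    obtain rfl := hcompl h hU hV
    rcases trichotomous_of r U Uᗮ with h | h | h
    · exact Or.inl (Or.inr ⟨hU, h⟩)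
    · exact absurd h (hne U)
    · exact Or.inr (Or.inr ⟨hV, by rwa [Submodule.orthogonal_orthogonal]⟩)
  refine ⟨f, fun n q hq hs => ?_⟩
  have hsum : ∀ s : Finset (Fin n), f (∑ i ∈ s, q i) → ∃ i ∈ s, f (q i) := by
    intro s
    induction s using Finset.induction_on with
    | empty => exact fun h => absurd h hbot
    | insert a s ha ih =>
      intro h
      rw [Finset.sum_insert ha] at h
      have ho : q a ⟂ ∑ i ∈ s, q i :=
        (Submodule.isOrtho_finset_sum_left s q (q a) fun i hi =>
          hq i a fun e => ha (e ▸ hi)).symm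
      rcases hor ho h with h | h
      · exact ⟨a, Finset.mem_insert_self a s, h⟩
      · obtain ⟨i, hi, hfi⟩ := ih h
        exact ⟨i, Finset.mem_insert_of_mem hi, hfi⟩
  obtain ⟨i, -, hi⟩ := hsum Finset.univ (hs ▸ htop)
  exact ⟨i, hi, fun j hj => by_contra fun hij => hnot (hq j i hij) hj hi⟩

end OrthogonalValuation

/-! ### Kochen–Specker for integer vectors -/

section KochenSpecker

/-- No valuation of integer vectors that is two-valued on orthogonal triples can be true at
`(1, 0, 0)` and at `(1, -1, 0)`. -/
theorem not_valuation_of_diagonal (g : ℤ → ℤ → ℤ → Prop)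
    (hpair : ∀ a b c a' b' c' : ℤ, a * a' + b * b' + c * c' = 0 → g a b c → ¬ g a' b' c')
    (htriple : ∀ a b c a' b' c' a'' b'' c'' : ℤ, a * a' + b * b' + c * c' = 0 →
      a * a'' + b * b'' + c * c'' = 0 → a' * a'' + b' * b'' + c' * c'' = 0 →
      a ^ 2 + b ^ 2 + c ^ 2 ≠ 0 → a' ^ 2 + b' ^ 2 + c' ^ 2 ≠ 0 → a'' ^ 2 + b'' ^ 2 + c'' ^ 2 ≠ 0 →
      ¬ g a b c → ¬ g a' b' c' → g a'' b'' c'')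
    (h₁ : g 1 0 0) (h₂ : g 1 (-1) 0) : False := by
  -- Each `n` or `m` is orthogonal to a true vector; each `p` completes an orthogonal triple whose
  -- other two members are false.
  have n₁ : ¬ g 0 1 (-1) := hpair 1 0 0 _ _ _ (by norm_num) h₁
  have n₂ : ¬ g 0 1 0 := hpair 1 0 0 _ _ _ (by norm_num) h₁
  have n₃ : ¬ g 0 1 1 := hpair 1 0 0 _ _ _ (by norm_num) h₁
  have n₄ : ¬ g 1 1 (-1) := hpair 1 (-1) 0 _ _ _ (by norm_num) h₂
  have n₅ : ¬ g 1 1 1 := hpair 1 (-1) 0 _ _ _ (by norm_num) h₂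
  have n₆ : ¬ g 2 2 (-1) := hpair 1 (-1) 0 _ _ _ (by norm_num) h₂
  have n₇ : ¬ g 2 2 1 := hpair 1 (-1) 0 _ _ _ (by norm_num) h₂
  have p₁ : g 2 (-1) (-1) := by apply htriple 0 1 (-1) 1 1 1 <;> first | assumption | norm_num
  have p₂ : g 2 (-1) 1 := by apply htriple 0 1 1 1 1 (-1) <;> first | assumption | norm_num
  have n₈ : ¬ g 1 0 2 := hpair 2 (-1) (-1) _ _ _ (by norm_num) p₁
  have n₉ : ¬ g 1 0 (-2) := hpair 2 (-1) 1 _ _ _ (by norm_num) p₂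
  have p₃ : g 2 0 1 := by apply htriple 0 1 0 1 0 (-2) <;> first | assumption | norm_num
  have p₄ : g 2 0 (-1) := by apply htriple 0 1 0 1 0 2 <;> first | assumption | norm_num
  have m₁ : ¬ g 1 (-2) (-2) := hpair 2 0 1 _ _ _ (by norm_num) p₃
  have m₂ : ¬ g 1 (-2) 2 := hpair 2 0 (-1) _ _ _ (by norm_num) p₄
  have p₅ : g 2 (-1) 2 := by apply htriple 1 (-2) (-2) 2 2 (-1) <;> first | assumption | norm_num
  have p₆ : g 2 (-1) (-2) := by apply htriple 1 (-2) 2 2 2 1 <;> first | assumption | norm_num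
  have m₃ : ¬ g 1 0 (-1) := hpair 2 (-1) 2 _ _ _ (by norm_num) p₅
  have m₄ : ¬ g 1 0 1 := hpair 2 (-1) (-2) _ _ _ (by norm_num) p₆
  -- The triple (0,1,0), (1,0,-1), (1,0,1) is entirely false.
  exact m₄ (by apply htriple 0 1 0 1 0 (-1) <;> first | assumption | norm_num)

/-- **Kochen–Specker**: there is no two-valued valuation of integer vectors. -/
theorem kochen_specker_int (g : ℤ → ℤ → ℤ → Prop)
    (hpair : ∀ a b c a' b' c' : ℤ, a * a' + b * b' + c * c' = 0 → g a b c → ¬ g a' b' c')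
    (htriple : ∀ a b c a' b' c' a'' b'' c'' : ℤ, a * a' + b * b' + c * c' = 0 →
      a * a'' + b * b'' + c * c'' = 0 → a' * a'' + b' * b'' + c' * c'' = 0 →
      a ^ 2 + b ^ 2 + c ^ 2 ≠ 0 → a' ^ 2 + b' ^ 2 + c' ^ 2 ≠ 0 → a'' ^ 2 + b'' ^ 2 + c'' ^ 2 ≠ 0 →
      ¬ g a b c → ¬ g a' b' c' → g a'' b'' c'')
    (h₁ : g 1 0 0) : False := by
  by_cases h₂ : g 1 (-1) 0
  · exact not_valuation_of_diagonal g hpair htriple h₁ h₂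
  have h₃ : ¬ g 0 0 1 := hpair 1 0 0 _ _ _ (by norm_num) h₁
  have h₄ : g 1 1 0 := by apply htriple 0 0 1 1 (-1) 0 <;> first | assumption | norm_num
  -- The reflection y ↦ -y preserves orthogonality, fixes (1,0,0) and swaps the two diagonals.
  refine not_valuation_of_diagonal (fun a b c => g a (-b) c) ?_ ?_ (by simpa using h₁)
    (by simpa using h₄)
  · intro a b c a' b' c' h
    exact hpair _ _ _ _ _ _ (by linarith)
  · intro a b c a' b' c' a'' b'' c'' h h' h'' k k' k''
    apply htriple <;> first | linarith | simpa

end KochenSpecker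

/-! ### Transfer to Hilbert spaces -/

section Obstruction

variable {𝕜 H : Type*} [RCLike 𝕜] [NormedAddCommGroup H] [InnerProductSpace 𝕜 H]

/-- The integer combination of three vectors. -/
def intComb (b : Fin 3 → H) (x y z : ℤ) : H := x • b 0 + y • b 1 + z • b 2

/-- Conjugation fixes integers, so real and complex scalars behave alike. -/
theorem inner_intComb {b : Fin 3 → H} (hb : Orthonormal 𝕜 b) (x y z x' y' z' : ℤ) :
    inner 𝕜 (intComb b x y z) (intComb b x' y' z') = ((x * x' + y * y' + z * z' : ℤ) : 𝕜) := by
  have h := orthonormal_iff_ite.1 hb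
  have hz : ∀ (n : ℤ) (v : H), n • v = (n : 𝕜) • v := fun n v => (Int.cast_smul_eq_zsmul 𝕜 n v).symm
  simp only [intComb, hz, inner_add_left, inner_add_right, inner_smul_left, inner_smul_right, h]
  simp [mul_comm]

theorem intComb_mem_span (b : Fin 3 → H) (x y z : ℤ) :
    intComb b x y z ∈ Submodule.span 𝕜 (Set.range b) := by
  have h : ∀ i, b i ∈ Submodule.span 𝕜 (Set.range b) :=
    fun i => Submodule.subset_span (Set.mem_range_self i)
  exact add_mem (add_mem (zsmul_mem (h 0) _) (zsmul_mem (h 1) _)) (zsmul_mem (h 2) _)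

theorem span_singleton_isOrtho {u v : H} (h : inner 𝕜 u v = 0) :
    Submodule.span 𝕜 {u} ⟂ Submodule.span 𝕜 {v} := by
  rw [Submodule.isOrtho_span]
  rintro _ rfl _ rfl
  exact h

/-- An orthogonal triple of nonzero vectors in a three-dimensional space contains a distinguished
line if the orthogonal complement of the space is not distinguished. -/
theorem IsOrthogonalValuation.exists_of_triple [FiniteDimensional 𝕜 H] {f : Submodule 𝕜 H → Prop}
    (hf : IsOrthogonalValuation f) {E : Submodule 𝕜 H} (hE : Module.finrank 𝕜 E = 3)
    (u : Fin 3 → H) (hu : ∀ i, u i ∈ E) (h0 : ∀ i, u i ≠ 0)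
    (ho : Pairwise fun i j => inner 𝕜 (u i) (u j) = 0) :
    f Eᗮ ∨ ∃ i, f (Submodule.span 𝕜 {u i}) := by
  have hspan : Submodule.span 𝕜 (Set.range u) = E := by
    refine Submodule.eq_of_le_of_finrank_eq ?_ ?_
    · rw [Submodule.span_le]
      rintro _ ⟨i, rfl⟩
      exact hu i
    · rw [finrank_span_eq_card (linearIndependent_of_ne_zero_of_inner_eq_zero h0 ho), hE]
      simp
  have hle : ∀ i, Submodule.span 𝕜 {u i} ≤ E := fun i => by
    rw [Submodule.span_singleton_le_iff_mem]
    exact hu i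
  obtain ⟨i, hi, -⟩ := hf 4 (Fin.cons Eᗮ fun i => Submodule.span 𝕜 {u i}) (by
    intro i j
    induction i using Fin.cases with
    | zero =>
      induction j using Fin.cases with
      | zero => exact fun hij => absurd rfl hij
      | succ j => exact fun _ => (Submodule.isOrtho_orthogonal_left E).mono_right (hle j)
    | succ i =>
      induction j using Fin.cases with
      | zero => exact fun _ => (Submodule.isOrtho_orthogonal_right E).mono_left (hle i)
      | succ j =>
        exact fun hij => span_singleton_isOrtho (ho fun h => hij (congrArg Fin.succ h))) (by
    have hs : ∑ i, Submodule.span 𝕜 {u i} = E := by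
      rw [← hspan, Submodule.span_range_eq_iSup, ← Finset.sup_univ_eq_iSup]
      rfl
    rw [Fin.sum_univ_succ]
    simp only [Fin.cons_zero, Fin.cons_succ]
    rw [hs, Submodule.add_eq_sup, sup_comm,
      Submodule.sup_orthogonal_of_hasOrthogonalProjection])
  induction i using Fin.cases with
  | zero => exact Or.inl hi
  | succ i => exact Or.inr ⟨i, hi⟩

/-- The distinguished line in E excludes Eᗮ, so `f` on the lines of integer combinations of `b` is a
valuation of integer vectors. -/
theorem not_isOrthogonalValuation_of_orthonormal [FiniteDimensional 𝕜 H]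
    {f : Submodule 𝕜 H → Prop} (hf : IsOrthogonalValuation f) {b : Fin 3 → H}
    (hb : Orthonormal 𝕜 b) (h0 : f (Submodule.span 𝕜 {b 0})) : False := by
  set E := Submodule.span 𝕜 (Set.range b) with hEdef
  have hE : Module.finrank 𝕜 E = 3 := by
    rw [finrank_span_eq_card hb.linearIndependent, Fintype.card_fin]
  have hEc : ¬ f Eᗮ := fun h => hf.not_and_of_isOrtho
    ((Submodule.isOrtho_orthogonal_right E).mono_left (Submodule.span_mono (by simp))) ⟨h0, h⟩
  have hz : ∀ {x y z x' y' z' : ℤ}, x * x' + y * y' + z * z' = 0 →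
      inner 𝕜 (intComb b x y z) (intComb b x' y' z') = 0 := fun h => by
    rw [inner_intComb hb, h, Int.cast_zero]
  have hne : ∀ {x y z : ℤ}, x ^ 2 + y ^ 2 + z ^ 2 ≠ 0 → intComb b x y z ≠ 0 := fun h h' => by
    have := inner_intComb (𝕜 := 𝕜) hb _ _ _ _ _ _ ▸ inner_self_eq_zero (𝕜 := 𝕜).2 h'
    rw [Int.cast_eq_zero] at this
    exact h (by linarith)
  refine kochen_specker_int (fun x y z => f (Submodule.span 𝕜 {intComb b x y z})) ?_ ?_
    (by simpa [intComb] using h0)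
  · intro a b c a' b' c' h h1 h2
    exact hf.not_and_of_isOrtho (span_singleton_isOrtho (hz h)) ⟨h1, h2⟩
  · intro x y z x' y' z' x'' y'' z'' h h' h'' k k' k'' n n'
    rcases hf.exists_of_triple hE ![intComb b x y z, intComb b x' y' z', intComb b x'' y'' z'']
      (by intro i; fin_cases i <;> exact intComb_mem_span b _ _ _)
      (by intro i; fin_cases i; exacts [hne k, hne k', hne k''])
      (by
        intro i j hij
        fin_cases i <;> fin_cases j <;> first | exact absurd rfl hij | skip
        exacts [hz h, hz h', inner_eq_zero_symm.1 (hz h), hz h'', inner_eq_zero_symm.1 (hz h'),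
          inner_eq_zero_symm.1 (hz h'')]) with h | ⟨i, hi⟩
    · exact absurd h hEc
    · fin_cases i
      exacts [absurd hi n, absurd hi n', hi]

/-- **Kochen–Specker**: two-valued measures exist in dimension at most two only. -/
theorem IsOrthogonalValuation.finrank_le_two [FiniteDimensional 𝕜 H] {f : Submodule 𝕜 H → Prop}
    (hf : IsOrthogonalValuation f) : Module.finrank 𝕜 H ≤ 2 := by
  by_contra! h
  let B := stdOrthonormalBasis 𝕜 H
  obtain ⟨i, hi, -⟩ := hf _ (fun i => Submodule.span 𝕜 {B i})
    (fun i j hij => span_singleton_isOrtho (B.orthonormal.2 hij)) (by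
      have := B.toBasis.span_eq
      rw [Submodule.span_range_eq_iSup, ← Finset.sup_univ_eq_iSup] at this
      rw [B.coe_toBasis] at this
      exact this)
  -- The swap makes the distinguished basis vector the first of the three.
  let e : Fin 3 ↪ Fin (Module.finrank 𝕜 H) :=
    (Fin.castLEEmb h).trans (Equiv.swap (Fin.castLE h 0) i).toEmbedding
  refine not_isOrthogonalValuation_of_orthonormal hf (b := B ∘ e)
    (B.orthonormal.comp e e.injective) ?_
  have : e 0 = i := Equiv.swap_apply_left (Fin.castLE h 0) i
  simpa [this] using hi

end Obstruction

theorem mainTheorem2 {𝕜 H : Type*} [RCLike 𝕜] [NormedAddCommGroup H] [InnerProductSpace 𝕜 H]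
    [FiniteDimensional 𝕜 H] [Nontrivial H] :
    Nonempty (MinionHom (quantumMinion 𝕜 H) dictatorMinion) ↔ Module.finrank 𝕜 H ≤ 2 := by
  constructor
  · rintro ⟨ξ⟩
    obtain ⟨f, hf⟩ := ξ.exists_isOrthogonalValuation
    exact hf.finrank_le_two
  · intro h
    obtain ⟨f, hf⟩ := exists_isOrthogonalValuation_of_finrank_le_two h
    exact hf.nonempty_minionHom
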